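/- Let $n,k\ge 0$ be integers and let $a_1,\dots,a_k\in\mathbb{R}^n$ be vectors whose zonotope $$\mathcal Z(a_1,\dots,a_k)=\Big\{\sum_{i=1}^k t_i a_i : 0\le t_i\le 1\Big\}$$ is $n$-dimensional. For every set $S\subseteq\{1,\dots,k\}$ of exactly $n$ indices such that $(a_i)_{i\in S}$ is linearly independent, call $P_S=\{\sum_{i\in S}t_ia_i : 0\le t_i\le 1\}$ a generating parallelotope of the zonotope (generating parallelotopes are indexed by the sets $S$). Then there is a choice of one translation vector $x_S\in\mathbb{R}^n$ for each such $S$ such that the translates $x_S+P_S$ tile the zonotope: 1. $\bigcup_S (x_S+P_S)=\mathcal Z(a_1,\dots,a_k)$; 2. for $S\neq T$ the intersection $(x_S+P_S)\cap(x_T+P_T)$ is a (possibly empty) face both of $x_S+P_S$ and of $x_T+P_T$, of dimension smaller than $n$. The tiles $x_S+P_S$ are pairwise distinct, so their number equals the number of sets $S$ as above. This number is at most $\binom{k}{n}$, and it equals $\binom{k}{n}$ if and only if every $n$ of the vectors $a_1,\dots,a_k$ (with distinct indices) are linearly independent. -/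

import Mathlib

noncomputable section

namespace ZonotopeTiling

variable {E : Type*} [NormedAddCommGroup E] [NormedSpace ℝ E]

/-- The zonotope `Z(a₁, …, aₖ) = {∑ tᵢ aᵢ | 0 ≤ tᵢ ≤ 1}` generated by a finite family of vectors,
with no independence assumed. (This is what Mathlib calls `parallelepiped`.) -/
def zonotope {ι : Type*} [Fintype ι] (a : ι → E) : Set E :=
  parallelepiped a

/-- The dimension of a set: the dimension of its affine hull (with value `0` on the empty set). -/
def affineDim (s : Set E) : ℕ :=
  Module.finrank ℝ (vectorSpan ℝ s)

/-- `F` is a face of `P` (the empty face is allowed) of dimension smaller than that of `P`. The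
faces of a convex polytope are the sets where a linear functional attains its maximum over the
polytope, together with the empty set; this is `IsExposed`. The empty face has dimension `-1`, hence
the non-emptiness in the dimension condition. -/
def IsLowerDimFace (F P : Set E) : Prop :=
  IsExposed ℝ P F ∧ (F.Nonempty → affineDim F < affineDim P)

/-- The family of sets `T i` tiles (or decomposes) `P`: its union is `P`, and any two different
members intersect in a lower-dimensional (possibly empty) face of each of the two. -/
structure IsTiling {ι : Type*} (P : Set E) (T : ι → Set E) : Prop where
  iUnion_eq : ⋃ i, T i = P
  inter_face : ∀ i j, i ≠ j →
    IsLowerDimFace (T i ∩ T j) (T i) ∧ IsLowerDimFace (T i ∩ T j) (T j)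

/-- The index sets of the generating parallelotopes of the zonotope generated by `a`, a family of
rank `r`: the sets of exactly `r` indices whose vectors are linearly independent. -/
def IsParallelotopeIndex {ι : Type*} (a : ι → E) (S : Finset ι) : Prop :=
  S.card = Set.finrank ℝ (Set.range a) ∧ LinearIndependent ℝ (fun i : S => a i)

/-- The translate by `x` of the subzonotope generated by the vectors `a i`, `i ∈ S`. -/
def translatedSubzonotope {ι : Type*} (a : ι → E) (S : Finset ι) (x : E) : Set E :=
  (fun y => x + y) '' zonotope (fun i : S => a i)

end ZonotopeTiling

end

namespace ZonotopeTiling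

section Lifting

variable {ι : Type*} [Fintype ι] {E : Type*} [NormedAddCommGroup E] [NormedSpace ℝ E]

theorem mem_zonotope {a : ι → E} {y : E} :
    y ∈ zonotope a ↔ ∃ t ∈ Set.Icc (0 : ι → ℝ) 1, y = ∑ i, t i • a i :=
  mem_parallelepiped_iff a y

/-- The vectors indexed by `S` form a basis. -/
def IsBasisIndex (a : ι → E) (S : Finset ι) : Prop :=
  LinearIndependent ℝ (fun i : S => a i) ∧ Submodule.span ℝ (a '' S) = ⊤

/-- The part of the zonotope lying below the lower face of the lifted zonotope
(with heights `w`) that is exposed by the linear functional `l`. -/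
def tile (a : ι → E) (w : ι → ℝ) (l : E →ₗ[ℝ] ℝ) : Set E :=
  {y | ∃ t ∈ Set.Icc (0 : ι → ℝ) 1, y = ∑ i, t i • a i ∧
    ∀ i, (w i < l (a i) → t i = 1) ∧ (l (a i) < w i → t i = 0)}

/-- The coefficients of the base vertex of `tile a w l`. -/
noncomputable def tileOffset (a : ι → E) (w : ι → ℝ) (l : E →ₗ[ℝ] ℝ) (i : ι) : ℝ :=
  open Classical in if w i < l (a i) then 1 else 0

/-- The constant term of the affine function which bounds the lifted zonotope from below
in the direction `l`. -/
noncomputable def supportConst (a : ι → E) (w : ι → ℝ) (l : E →ₗ[ℝ] ℝ) : ℝ :=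
  ∑ i, min 0 (w i - l (a i))

/-- Heights such that the lifts of the vectors outside a basis avoid the hyperplane spanned by the
lifted basis. -/
def IsGeneric (a : ι → E) (w : ι → ℝ) : Prop :=
  ∀ S, IsBasisIndex a S → ∀ l : E →ₗ[ℝ] ℝ, (∀ i ∈ S, l (a i) = w i) → ∀ j ∉ S, l (a j) ≠ w j

omit [Fintype ι] in
theorem IsBasisIndex.exists_functional {a : ι → E} {S : Finset ι} (h : IsBasisIndex a S)
    (w : ι → ℝ) : ∃ l : E →ₗ[ℝ] ℝ, ∀ i ∈ S, l (a i) = w i := by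
  have hsp : ⊤ ≤ Submodule.span ℝ (Set.range fun i : S => a i) := by
    rw [← h.2]
    apply Submodule.span_mono
    rintro _ ⟨i, hi, rfl⟩
    exact ⟨⟨i, hi⟩, rfl⟩
  let b := Module.Basis.mk h.1 hsp
  refine ⟨b.constr ℝ fun i : S => w i, fun i hi => ?_⟩
  have hb : b ⟨i, hi⟩ = a i := by simp [b]
  rw [← hb, Module.Basis.constr_basis]

theorem IsBasisIndex.exists_coeff {a : ι → E} {S : Finset ι} (h : IsBasisIndex a S)
    (y : E) : ∃ c : ι → ℝ, (∀ i ∉ S, c i = 0) ∧ ∑ i, c i • a i = y := by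
  classical
  have hy : y ∈ Submodule.span ℝ (a '' S) := by rw [h.2]; trivial
  obtain ⟨c, hc⟩ := (Submodule.mem_span_image_finset_iff_exists_fun ℝ).1 hy
  refine ⟨fun i => if hi : i ∈ S then c ⟨i, hi⟩ else 0, fun i hi => by simp [hi], ?_⟩
  rw [← hc, ← Finset.sum_subset (Finset.subset_univ S)]
  · rw [← Finset.sum_coe_sort S]
    simp
  · intro i _ hi
    simp [hi]

theorem exists_isGeneric (a : ι → E) : ∃ w, IsGeneric a w := by
  classical
  let κ := {p : Finset ι × ι // IsBasisIndex a p.1 ∧ p.2 ∉ p.1}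
  have hc (p : κ) := p.2.1.exists_coeff (a p.1.2)
  choose c hc0 hc using hc
  let φ (p : κ) : Module.Dual ℝ (ι → ℝ) :=
    LinearMap.proj p.1.2 - ∑ i, c p i • LinearMap.proj i
  have hφ (p : κ) (w : ι → ℝ) : φ p w = w p.1.2 - ∑ i, c p i * w i := by
    simp [φ]
  obtain ⟨w, hw⟩ := Module.Dual.exists_forall_ne_zero_of_forall_exists φ (fun p => by
    refine ⟨Pi.single p.1.2 1, ?_⟩
    rw [hφ]
    simp [Pi.single_apply, hc0 p _ p.2.2])
  refine ⟨w, fun S hS l hl j hj h => hw ⟨(S, j), hS, hj⟩ ?_⟩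
  rw [hφ, ← h, sub_eq_zero]
  conv_lhs => rw [← hc ⟨(S, j), hS, hj⟩]
  rw [map_sum]
  refine Finset.sum_congr rfl fun i _ => ?_
  by_cases hi : i ∈ S
  · simp [hl i hi]
  · simp [hc0 ⟨(S, j), hS, hj⟩ i hi]

theorem sum_mul_height (a : ι → E) (w t : ι → ℝ) (l : E →ₗ[ℝ] ℝ) :
    ∑ i, t i * w i = l (∑ i, t i • a i) + ∑ i, t i * (w i - l (a i)) := by
  rw [map_sum, ← Finset.sum_add_distrib]
  refine Finset.sum_congr rfl fun i _ => ?_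
  simp only [map_smul, smul_eq_mul]
  ring

theorem min_zero_le_mul {t x : ℝ} (h0 : 0 ≤ t) (h1 : t ≤ 1) : min 0 x ≤ t * x := by
  rcases le_total 0 x with h | h
  · rw [min_eq_left h]; positivity
  · rw [min_eq_right h]; nlinarith

theorem min_zero_eq_mul_iff {t x : ℝ} :
    min 0 x = t * x ↔ (x < 0 → t = 1) ∧ (0 < x → t = 0) := by
  rcases lt_trichotomy x 0 with h | rfl | h
  · rw [min_eq_right h.le]
    have : x = t * x ↔ t = 1 := by
      rw [eq_comm, mul_eq_right₀ h.ne]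
    simp [this, h, h.le]
  · simp
  · rw [min_eq_left h.le]
    simp [h, h.ne', h.le]

theorem supportConst_le (a : ι → E) (w : ι → ℝ) (l : E →ₗ[ℝ] ℝ) {t : ι → ℝ}
    (ht : t ∈ Set.Icc (0 : ι → ℝ) 1) :
    l (∑ i, t i • a i) + supportConst a w l ≤ ∑ i, t i * w i := by
  rw [sum_mul_height a w t l]
  gcongr
  exact Finset.sum_le_sum fun i _ => min_zero_le_mul (ht.1 i) (ht.2 i)

theorem supportConst_eq_iff (a : ι → E) (w : ι → ℝ) (l : E →ₗ[ℝ] ℝ) {t : ι → ℝ}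
    (ht : t ∈ Set.Icc (0 : ι → ℝ) 1) :
    l (∑ i, t i • a i) + supportConst a w l = ∑ i, t i * w i ↔
      ∀ i, (w i < l (a i) → t i = 1) ∧ (l (a i) < w i → t i = 0) := by
  rw [sum_mul_height a w t l, add_right_inj, supportConst,
    Finset.sum_eq_sum_iff_of_le fun i _ => min_zero_le_mul (ht.1 i) (ht.2 i)]
  simp [min_zero_eq_mul_iff]

theorem tile_subset_zonotope (a : ι → E) (w : ι → ℝ) (l : E →ₗ[ℝ] ℝ) :
    tile a w l ⊆ zonotope a := by
  rintro y ⟨t, ht, hy, -⟩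
  exact mem_zonotope.2 ⟨t, ht, hy⟩

theorem le_of_mem_tile {a : ι → E} {w : ι → ℝ} {l : E →ₗ[ℝ] ℝ} (l' : E →ₗ[ℝ] ℝ) {y : E}
    (hy : y ∈ tile a w l) : l' y + supportConst a w l' ≤ l y + supportConst a w l := by
  obtain ⟨t, ht, rfl, h⟩ := hy
  rw [(supportConst_eq_iff a w l ht).2 h]
  exact supportConst_le a w l' ht

theorem mem_tile_iff_of_mem_tile {a : ι → E} {w : ι → ℝ} {l l' : E →ₗ[ℝ] ℝ} {y : E}
    (hy : y ∈ tile a w l) :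
    y ∈ tile a w l' ↔ l' y + supportConst a w l' = l y + supportConst a w l := by
  refine ⟨fun hy' => (le_of_mem_tile l' hy).antisymm (le_of_mem_tile l hy'), fun h => ?_⟩
  obtain ⟨t, ht, rfl, h'⟩ := hy
  rw [(supportConst_eq_iff a w l ht).2 h'] at h
  exact ⟨t, ht, rfl, (supportConst_eq_iff a w l' ht).1 h⟩

theorem isCompact_tile (a : ι → E) (w : ι → ℝ) (l : E →ₗ[ℝ] ℝ) : IsCompact (tile a w l) := by
  have hc : IsClosed {t : ι → ℝ |
      ∀ i, (w i < l (a i) → t i = 1) ∧ (l (a i) < w i → t i = 0)} := by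
    simp only [Set.ofPred_forall, Set.ofPred_and]
    refine isClosed_iInter fun i => IsClosed.inter ?_ ?_
    · exact isClosed_iInter fun _ => isClosed_eq (continuous_apply i) continuous_const
    · exact isClosed_iInter fun _ => isClosed_eq (continuous_apply i) continuous_const
  have hf : Continuous fun t : ι → ℝ => ∑ i, t i • a i := by fun_prop
  convert ((isCompact_Icc (a := (0 : ι → ℝ)) (b := 1)).inter_right hc).image hf using 1
  ext y
  simp only [tile, Set.mem_ofPred_eq, Set.mem_image, Set.mem_inter_iff]
  exact exists_congr fun t => by rw [and_assoc, eq_comm, and_comm (a := _ = _)]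

omit [Fintype ι] in
theorem tileOffset_mem_Icc (a : ι → E) (w : ι → ℝ) (l : E →ₗ[ℝ] ℝ) (i : ι) :
    0 ≤ tileOffset a w l i ∧ tileOffset a w l i ≤ 1 := by
  unfold tileOffset
  split_ifs <;> simp

theorem translatedSubzonotope_eq_tile {a : ι → E} {w : ι → ℝ} (hw : IsGeneric a w)
    {S : Finset ι} (hS : IsBasisIndex a S) {l : E →ₗ[ℝ] ℝ} (hl : ∀ i ∈ S, l (a i) = w i) :
    translatedSubzonotope a S (∑ i, tileOffset a w l i • a i) = tile a w l := by
  classical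
  have hoff (i : ι) (hi : i ∈ S) : tileOffset a w l i = 0 := by simp [tileOffset, hl i hi]
  ext y
  simp only [translatedSubzonotope, Set.mem_image, mem_zonotope]
  constructor
  · rintro ⟨_, ⟨t, ht, rfl⟩, rfl⟩
    refine ⟨fun i => if hi : i ∈ S then t ⟨i, hi⟩ else tileOffset a w l i, ⟨?_, ?_⟩, ?_, ?_⟩
    · intro i
      dsimp only
      split_ifs with hi
      exacts [ht.1 _, (tileOffset_mem_Icc a w l i).1]
    · intro i
      dsimp only
      split_ifs with hi
      exacts [ht.2 _, (tileOffset_mem_Icc a w l i).2]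
    · have h1 : ∑ i : S, t i • a i = ∑ i, (if hi : i ∈ S then t ⟨i, hi⟩ else 0) • a i := by
        rw [← Finset.sum_subset (Finset.subset_univ S) (by intro i _ hi; simp [hi]),
          ← Finset.sum_coe_sort S]
        simp
      rw [h1, ← Finset.sum_add_distrib]
      refine Finset.sum_congr rfl fun i _ => ?_
      by_cases hi : i ∈ S <;> simp [hi, hoff]
    · intro i
      by_cases hi : i ∈ S
      · simp [hl i hi]
      · simp only [hi, dite_false, tileOffset]
        exact ⟨fun h => by simp [h], fun h => by simp [h.le]⟩
  · rintro ⟨t, ht, rfl, h⟩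
    refine ⟨_, ⟨fun i => t i, ⟨fun i => ht.1 i, fun i => ht.2 i⟩, rfl⟩, ?_⟩
    rw [Finset.sum_coe_sort S fun i => t i • a i,
      Finset.sum_subset_zero_on_sdiff (g := fun i => (if i ∈ S then t i else 0) • a i)
        (Finset.subset_univ S) (by intro i hi; simp [(Finset.mem_sdiff.1 hi).2])
        (by intro i hi; simp [hi]), ← Finset.sum_add_distrib]
    refine Finset.sum_congr rfl fun i _ => ?_
    by_cases hi : i ∈ S
    · simp [hi, hoff]
    · rcases (hw S hS l hl i hi).lt_or_gt with h' | h'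
      · simp [hi, tileOffset, h'.le, (h i).2 h']
      · simp [hi, tileOffset, h', (h i).1 h']

theorem vectorSpan_tile_eq_top {a : ι → E} {w : ι → ℝ} {S : Finset ι} (hS : IsBasisIndex a S)
    {l : E →ₗ[ℝ] ℝ} (hl : ∀ i ∈ S, l (a i) = w i) : vectorSpan ℝ (tile a w l) = ⊤ := by
  classical
  rw [eq_top_iff, ← hS.2, Submodule.span_le]
  rintro _ ⟨i, hi, rfl⟩
  have hoff : tileOffset a w l i = 0 := by simp [tileOffset, hl i hi]
  have hval (j : ι) : (w j < l (a j) → tileOffset a w l j = 1) ∧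
      (l (a j) < w j → tileOffset a w l j = 0) :=
    ⟨fun h => by simp [tileOffset, h], fun h => by simp [tileOffset, h.le]⟩
  have h0 : ∑ j, tileOffset a w l j • a j ∈ tile a w l :=
    ⟨_, ⟨fun j => (tileOffset_mem_Icc a w l j).1, fun j => (tileOffset_mem_Icc a w l j).2⟩, rfl,
      hval⟩
  have h1 : ∑ j, tileOffset a w l j • a j + a i ∈ tile a w l := by
    refine ⟨Function.update (tileOffset a w l) i 1, ⟨fun j => ?_, fun j => ?_⟩, ?_, fun j => ?_⟩
    · by_cases hj : j = i
      · subst hj; simp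
      · simpa [hj] using (tileOffset_mem_Icc a w l j).1
    · by_cases hj : j = i
      · subst hj; simp
      · simpa [hj] using (tileOffset_mem_Icc a w l j).2
    · rw [← Finset.add_sum_erase _ _ (Finset.mem_univ i),
        ← Finset.add_sum_erase _ _ (Finset.mem_univ i), hoff]
      simp only [zero_smul, zero_add, Function.update_self, one_smul]
      rw [add_comm]
      congr 1
      refine Finset.sum_congr rfl fun j hj => ?_
      rw [Function.update_of_ne (Finset.ne_of_mem_erase hj)]
    · by_cases hj : j = i
      · subst hj; simp [hl j hi]
      · simpa [hj] using hval j
  simpa using vsub_mem_vectorSpan ℝ h1 h0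

variable [FiniteDimensional ℝ E]

theorem isExposed_tile_inter (a : ι → E) (w : ι → ℝ) (l l' : E →ₗ[ℝ] ℝ) :
    IsExposed ℝ (tile a w l) (tile a w l ∩ tile a w l') := by
  rintro ⟨z, hz, hz'⟩
  refine ⟨LinearMap.toContinuousLinearMap (l' - l), ?_⟩
  have hz2 := (mem_tile_iff_of_mem_tile hz).1 hz'
  ext y
  simp only [Set.mem_inter_iff, Set.mem_ofPred_eq, LinearMap.coe_toContinuousLinearMap',
    LinearMap.sub_apply]
  refine and_congr_right fun hy => ?_
  rw [mem_tile_iff_of_mem_tile hy]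
  constructor
  · intro h x hx
    linarith [le_of_mem_tile l' hx]
  · intro h
    linarith [le_of_mem_tile l' hy, h z hz]

theorem affineDim_tile_inter_lt {a : ι → E} {w : ι → ℝ} {l l' : E →ₗ[ℝ] ℝ} (hne : l ≠ l')
    (htop : vectorSpan ℝ (tile a w l) = ⊤) :
    affineDim (tile a w l ∩ tile a w l') < affineDim (tile a w l) := by
  have hle : vectorSpan ℝ (tile a w l ∩ tile a w l') ≤ LinearMap.ker (l' - l) := by
    rw [vectorSpan_def, Submodule.span_le]
    rintro _ ⟨x, hx, y, hy, rfl⟩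
    have h1 := (mem_tile_iff_of_mem_tile hx.1).1 hx.2
    have h2 := (mem_tile_iff_of_mem_tile hy.1).1 hy.2
    simp only [vsub_eq_sub, SetLike.mem_coe, LinearMap.mem_ker, LinearMap.sub_apply, map_sub]
    linarith
  unfold affineDim
  rw [htop, finrank_top]
  apply Submodule.finrank_lt
  intro h
  rw [h, top_le_iff, LinearMap.ker_eq_top, sub_eq_zero] at hle
  exact hne hle.symm

omit [Fintype ι] [FiniteDimensional ℝ E] in
theorem functional_ne {a : ι → E} {w : ι → ℝ} (hw : IsGeneric a w) {S T : Finset ι}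
    (hS : IsBasisIndex a S) (hST : ¬ T ⊆ S) {l l' : E →ₗ[ℝ] ℝ}
    (hl : ∀ i ∈ S, l (a i) = w i) (hl' : ∀ i ∈ T, l' (a i) = w i) : l ≠ l' := by
  obtain ⟨j, hjT, hjS⟩ := Finset.not_subset.1 hST
  rintro rfl
  exact hw S hS l hl j hjS (hl' j hjT)

end Lifting

section Covering

variable {ι : Type*} [Fintype ι] {E : Type*} [NormedAddCommGroup E] [NormedSpace ℝ E]

theorem exists_minimal_cost {a : ι → E} (w : ι → ℝ) {y : E} (hy : y ∈ zonotope a) :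
    ∃ t ∈ Set.Icc (0 : ι → ℝ) 1, y = ∑ i, t i • a i ∧
      ∀ s ∈ Set.Icc (0 : ι → ℝ) 1, y = ∑ i, s i • a i → ∑ i, t i * w i ≤ ∑ i, s i * w i := by
  have hf : Continuous fun t : ι → ℝ => ∑ i, t i • a i := by fun_prop
  have hg : Continuous fun t : ι → ℝ => ∑ i, t i * w i := by fun_prop
  have hK : IsCompact (Set.Icc (0 : ι → ℝ) 1 ∩ {t | y = ∑ i, t i • a i}) :=
    isCompact_Icc.inter_right (isClosed_eq continuous_const hf)
  obtain ⟨s, hs, hys⟩ := mem_zonotope.1 hy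
  obtain ⟨t, ⟨ht, hyt⟩, hmin⟩ := hK.exists_isMinOn ⟨s, hs, hys⟩ hg.continuousOn
  exact ⟨t, ht, hyt, fun s hs hys => hmin ⟨hs, hys⟩⟩

theorem exists_pos_add_smul_mem_Icc {t d : ι → ℝ} (ht : t ∈ Set.Icc (0 : ι → ℝ) 1)
    (h0 : ∀ i, t i = 0 → 0 ≤ d i) (h1 : ∀ i, t i = 1 → d i ≤ 0) :
    ∃ ε > (0 : ℝ), t + ε • d ∈ Set.Icc (0 : ι → ℝ) 1 := by
  have hlim (i : ι) : Filter.Tendsto (fun ε : ℝ => t i + ε * d i) (nhdsWithin 0 (Set.Ioi 0))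
      (nhds (t i)) := by
    have hc : Continuous fun ε : ℝ => t i + ε * d i := by fun_prop
    simpa using (hc.tendsto 0).mono_left nhdsWithin_le_nhds
  have hpos : ∀ᶠ ε : ℝ in nhdsWithin 0 (Set.Ioi 0), 0 < ε := self_mem_nhdsWithin
  have hev (i : ι) : ∀ᶠ ε : ℝ in nhdsWithin 0 (Set.Ioi 0),
      0 ≤ t i + ε * d i ∧ t i + ε * d i ≤ 1 := by
    have hl : ∀ᶠ ε : ℝ in nhdsWithin 0 (Set.Ioi 0), 0 ≤ t i + ε * d i := by
      rcases (ht.1 i).eq_or_lt with h | h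
      · filter_upwards [hpos] with ε hε
        have := mul_nonneg hε.le (h0 i h.symm)
        rw [← h]
        simpa using this
      · exact ((hlim i).eventually (lt_mem_nhds h)).mono fun _ h => h.le
    have hu : ∀ᶠ ε : ℝ in nhdsWithin 0 (Set.Ioi 0), t i + ε * d i ≤ 1 := by
      rcases (ht.2 i).eq_or_lt with h | h
      · filter_upwards [hpos] with ε hε
        have := mul_nonpos_of_nonneg_of_nonpos hε.le (h1 i h)
        rw [h]
        simpa using this
      · exact ((hlim i).eventually (gt_mem_nhds h)).mono fun _ h => h.le
    exact hl.and hu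
  obtain ⟨ε, hε, h⟩ := (hpos.and (Filter.eventually_all.2 hev)).exists
  exact ⟨ε, hε, fun i => (h i).1, fun i => (h i).2⟩

/-- Complementary slackness: a cost-minimal point whose fractional coordinates contain a basis lies
in the tile of that basis. -/
theorem mem_tile_of_minimal {a : ι → E} {w t : ι → ℝ} (ht : t ∈ Set.Icc (0 : ι → ℝ) 1)
    (hmin : ∀ s ∈ Set.Icc (0 : ι → ℝ) 1, ∑ i, t i • a i = ∑ i, s i • a i →
      ∑ i, t i * w i ≤ ∑ i, s i * w i)
    {S : Finset ι} (hS : IsBasisIndex a S) (hfrac : ∀ i ∈ S, 0 < t i ∧ t i < 1)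
    {l : E →ₗ[ℝ] ℝ} (hl : ∀ i ∈ S, l (a i) = w i) :
    ∑ i, t i • a i ∈ tile a w l := by
  classical
  have key (d : ι → ℝ) (hd : ∑ i, d i • a i = 0) (h0 : ∀ i, t i = 0 → 0 ≤ d i)
      (h1 : ∀ i, t i = 1 → d i ≤ 0) : 0 ≤ ∑ i, d i * (w i - l (a i)) := by
    obtain ⟨ε, hε, hm⟩ := exists_pos_add_smul_mem_Icc ht h0 h1
    have hsum : ∑ i, (t + ε • d) i • a i = ∑ i, t i • a i := by
      simp only [Pi.add_apply, Pi.smul_apply, add_smul, Finset.sum_add_distrib, smul_assoc]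
      rw [← Finset.smul_sum, hd, smul_zero, add_zero]
    have h := hmin _ hm hsum.symm
    have h2 : ∑ i, (t + ε • d) i * w i = ∑ i, t i * w i + ε * ∑ i, d i * w i := by
      simp only [Pi.add_apply, Pi.smul_apply, smul_eq_mul, add_mul, Finset.sum_add_distrib,
        Finset.mul_sum, mul_assoc]
    have h3 := sum_mul_height a w d l
    rw [hd, map_zero, zero_add] at h3
    rw [← h3]
    rw [h2] at h
    exact nonneg_of_mul_nonneg_right (by linarith) hε
  have dir (j : ι) (hj : j ∉ S) : ∃ d : ι → ℝ, d j = 1 ∧ (∀ i, i ≠ j → i ∉ S → d i = 0) ∧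
      ∑ i, d i • a i = 0 := by
    obtain ⟨c, hc0, hc⟩ := hS.exists_coeff (a j)
    refine ⟨fun i => Pi.single (M := fun _ => ℝ) j 1 i - c i, by simp [hc0 j hj],
      fun i hij hi => by simp [hij, hc0 i hi], ?_⟩
    simp [sub_smul, Finset.sum_sub_distrib, hc, Pi.single_apply]
  have val (j : ι) (d : ι → ℝ) (hd : ∀ i, i ≠ j → i ∉ S → d i = 0) :
      ∑ i, d i * (w i - l (a i)) = d j * (w j - l (a j)) := by
    refine Finset.sum_eq_single j (fun i _ hij => ?_) (by simp)
    by_cases hi : i ∈ S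
    · simp [hl i hi]
    · simp [hd i hij hi]
  refine ⟨t, ht, rfl, fun j => ?_⟩
  by_cases hj : j ∈ S
  · simp [hl j hj]
  obtain ⟨d, hdj, hd0, hd⟩ := dir j hj
  constructor
  · intro hlt
    by_contra hne
    have h := key d hd (fun i hi => ?_) (fun i hi => ?_)
    · rw [val j d hd0, hdj] at h
      linarith
    all_goals
      by_cases hij : i = j
      · subst hij
        first
        | exact absurd hi hne
        | simp [hdj]
      · have : i ∉ S := fun h => by
          have := hfrac i h
          linarith
        simp [hd0 i hij this]
  · intro hlt
    by_contra hne
    have h := key (-d) (by simpa using hd) (fun i hi => ?_) (fun i hi => ?_)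
    · rw [val j (-d) fun i hij hi => by simp [hd0 i hij hi], Pi.neg_apply, hdj] at h
      linarith
    all_goals
      by_cases hij : i = j
      · subst hij
        first
        | exact absurd hi hne
        | simp [hdj]
      · have : i ∉ S := fun h => by
          have := hfrac i h
          linarith
        simp [hd0 i hij this]

variable [FiniteDimensional ℝ E]

/-- Almost every point is not covered by the lower-dimensional translated spans. -/
theorem dense_forall_sub_notMem_span (a : ι → E) :
    Dense {y : E | ∀ A F : Finset ι, Submodule.span ℝ (a '' F) ≠ ⊤ →
      y - ∑ i ∈ A, a i ∉ Submodule.span ℝ (a '' F)} := by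
  let _ : MeasurableSpace E := borel E
  have : BorelSpace E := ⟨rfl⟩
  apply MeasureTheory.Measure.dense_of_ae (μ := MeasureTheory.Measure.addHaar)
  simp only [MeasureTheory.ae_all_iff]
  intro A F hF
  rw [MeasureTheory.ae_iff]
  refine MeasureTheory.measure_mono_null ?_ (MeasureTheory.Measure.addHaar_affineSubspace _
    (AffineSubspace.mk' (∑ i ∈ A, a i) (Submodule.span ℝ (a '' F))) fun h => hF ?_)
  · intro y hy
    simpa [AffineSubspace.mem_mk'] using hy
  · rw [← AffineSubspace.direction_mk' (∑ i ∈ A, a i) (Submodule.span ℝ (a '' F)), h,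
      AffineSubspace.direction_top]

theorem interior_zonotope_nonempty {a : ι → E} (h : vectorSpan ℝ (zonotope a) = ⊤) :
    (interior (zonotope a)).Nonempty := by
  have hconv : Convex ℝ (zonotope a) := convex_parallelepiped a
  have h0 : (zonotope a).Nonempty := ⟨0, mem_zonotope.2 ⟨0, ⟨le_rfl, zero_le_one⟩, by simp⟩⟩
  rw [hconv.interior_nonempty_iff_affineSpan_eq_top,
    ← AffineSubspace.direction_eq_top_iff_of_nonempty ((affineSpan_nonempty ℝ).2 h0),
    direction_affineSpan, h]

omit [FiniteDimensional ℝ E] in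
theorem exists_basis_mem_tile {a : ι → E} (w : ι → ℝ) {y : E} (hy : y ∈ zonotope a)
    (hgen : ∀ A F : Finset ι, Submodule.span ℝ (a '' F) ≠ ⊤ →
      y - ∑ i ∈ A, a i ∉ Submodule.span ℝ (a '' F)) :
    ∃ S, IsBasisIndex a S ∧
      ∀ l : E →ₗ[ℝ] ℝ, (∀ i ∈ S, l (a i) = w i) → y ∈ tile a w l := by
  classical
  obtain ⟨t, ht, rfl, hmin⟩ := exists_minimal_cost w hy
  let F : Finset ι := {i | 0 < t i ∧ t i < 1}
  let A : Finset ι := {i | t i = 1}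
  have hF : Submodule.span ℝ (a '' F) = ⊤ := by
    by_contra hF
    apply hgen A F hF
    have hA : ∑ i ∈ A, a i = ∑ i, (if i ∈ A then (1 : ℝ) else 0) • a i := by simp
    rw [hA, ← Finset.sum_sub_distrib]
    refine Submodule.sum_mem _ fun i _ => ?_
    rw [← sub_smul]
    by_cases hi : i ∈ F
    · exact Submodule.smul_mem _ _ (Submodule.subset_span ⟨i, hi, rfl⟩)
    · have h01 : t i = 0 ∨ t i = 1 := by
        by_contra! h
        exact hi (by simpa [F] using ⟨(ht.1 i).lt_of_ne h.1.symm, (ht.2 i).lt_of_ne h.2⟩)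
      rcases h01 with h | h <;> simp [A, h]
  obtain ⟨b, hbF, -, hsp, hli⟩ := exists_linearIndepOn_extension
    (linearIndepOn_empty ℝ a) (Set.empty_subset (F : Set ι))
  lift b to Finset ι using b.toFinite
  refine ⟨b, ⟨hli, ?_⟩, fun l hl => mem_tile_of_minimal ht hmin ⟨hli, ?_⟩ (fun i hi => ?_) hl⟩
  iterate 2 exact top_le_iff.1 (hF ▸ Submodule.span_le.2 hsp)
  simpa [F] using hbF hi

theorem iUnion_tile_eq {a : ι → E} (h : vectorSpan ℝ (zonotope a) = ⊤) (w : ι → ℝ)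
    (l : {S // IsBasisIndex a S} → E →ₗ[ℝ] ℝ) (hl : ∀ S, ∀ i ∈ S.1, l S (a i) = w i) :
    ⋃ S, tile a w (l S) = zonotope a := by
  refine (Set.iUnion_subset fun S => tile_subset_zonotope a w (l S)).antisymm ?_
  have hclosed : IsClosed (⋃ S, tile a w (l S)) :=
    isClosed_iUnion_of_finite fun S => (isCompact_tile a w (l S)).isClosed
  have hconv : Convex ℝ (zonotope a) := convex_parallelepiped a
  calc zonotope a ⊆ closure (interior (zonotope a)) := by
        rw [hconv.closure_interior_eq_closure_of_nonempty_interior (interior_zonotope_nonempty h)]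
        exact subset_closure
    _ ⊆ ⋃ S, tile a w (l S) := by
        refine closure_minimal (((dense_forall_sub_notMem_span a).open_subset_closure_inter
          isOpen_interior).trans (closure_minimal ?_ hclosed)) hclosed
        rintro y ⟨hy, hgen⟩
        obtain ⟨S, hS, hmem⟩ := exists_basis_mem_tile w (interior_subset hy) hgen
        exact Set.mem_iUnion.2 ⟨⟨S, hS⟩, hmem _ (hl ⟨S, hS⟩)⟩

omit [FiniteDimensional ℝ E] in
theorem span_range_eq_top {a : ι → E} (h : vectorSpan ℝ (zonotope a) = ⊤) :
    Submodule.span ℝ (Set.range a) = ⊤ := by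
  rw [eq_top_iff, ← h, vectorSpan_def, Submodule.span_le]
  have hz : ∀ x ∈ zonotope a, x ∈ Submodule.span ℝ (Set.range a) := by
    intro x hx
    obtain ⟨t, -, rfl⟩ := mem_zonotope.1 hx
    exact Submodule.sum_mem _ fun i _ =>
      Submodule.smul_mem _ _ (Submodule.subset_span ⟨i, rfl⟩)
  rintro _ ⟨x, hx, y, hy, rfl⟩
  exact Submodule.sub_mem _ (hz x hx) (hz y hy)

omit [Fintype ι] [FiniteDimensional ℝ E] in
theorem isParallelotopeIndex_iff_card {a : ι → E} (h : Submodule.span ℝ (Set.range a) = ⊤)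
    {S : Finset ι} : IsParallelotopeIndex a S ↔
      S.card = Module.finrank ℝ E ∧ LinearIndependent ℝ (fun i : S => a i) := by
  rw [IsParallelotopeIndex, Set.finrank, h, finrank_top]

omit [Fintype ι] in
theorem IsParallelotopeIndex.isBasisIndex {a : ι → E} (h : Submodule.span ℝ (Set.range a) = ⊤)
    {S : Finset ι} (hS : IsParallelotopeIndex a S) : IsBasisIndex a S := by
  rw [isParallelotopeIndex_iff_card h] at hS
  refine ⟨hS.2, ?_⟩
  rw [← hS.2.span_eq_top_of_card_eq_finrank' (by simpa using hS.1), Set.image_eq_range]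
  rfl

omit [Fintype ι] [FiniteDimensional ℝ E] in
theorem IsBasisIndex.isParallelotopeIndex {a : ι → E} {S : Finset ι} (hS : IsBasisIndex a S) :
    IsParallelotopeIndex a S := by
  have h : Submodule.span ℝ (Set.range a) = ⊤ :=
    top_le_iff.1 (hS.2 ▸ Submodule.span_mono (Set.image_subset_range a S))
  rw [isParallelotopeIndex_iff_card h]
  refine ⟨?_, hS.1⟩
  have h1 := finrank_span_eq_card hS.1
  have h2 : Set.range (fun i : S => a i) = a '' S := by rw [Set.image_eq_range]; rfl
  rw [h2, hS.2, finrank_top] at h1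
  simpa using h1.symm

/-- A full-dimensional zonotope is tiled by translates of its generating parallelotopes. -/
theorem exists_isTiling {a : ι → E} (h : vectorSpan ℝ (zonotope a) = ⊤) :
    ∃ x : {S : Finset ι // IsParallelotopeIndex a S} → E,
      IsTiling (zonotope a) (fun S => translatedSubzonotope a S.1 (x S)) ∧
      Function.Injective fun S => translatedSubzonotope a S.1 (x S) := by
  have hspan := span_range_eq_top h
  obtain ⟨w, hw⟩ := exists_isGeneric a
  choose l hl using fun S : {S // IsBasisIndex a S} => S.2.exists_functional w
  let e (S : {S // IsParallelotopeIndex a S}) : {S // IsBasisIndex a S} :=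
    ⟨S.1, S.2.isBasisIndex hspan⟩
  have he : Function.Surjective e := fun S => ⟨⟨S.1, S.2.isParallelotopeIndex⟩, rfl⟩
  refine ⟨fun S => ∑ i, tileOffset a w (l (e S)) i • a i, ?_⟩
  have htile (S : {S // IsParallelotopeIndex a S}) :
      translatedSubzonotope a S.1 (∑ i, tileOffset a w (l (e S)) i • a i) = tile a w (l (e S)) :=
    translatedSubzonotope_eq_tile hw (e S).2 (hl (e S))
  simp only [htile]
  have htop (S : {S // IsParallelotopeIndex a S}) : vectorSpan ℝ (tile a w (l (e S))) = ⊤ :=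
    vectorSpan_tile_eq_top (e S).2 (hl (e S))
  have hne (S T : {S // IsParallelotopeIndex a S}) (hST : S ≠ T) : l (e S) ≠ l (e T) := by
    refine functional_ne hw (e S).2 (fun hsub => hST (Subtype.ext ?_)) (hl (e S)) (hl (e T))
    exact (Finset.eq_of_subset_of_card_le hsub (S.2.1.trans T.2.1.symm).le).symm
  have hface (S T : {S // IsParallelotopeIndex a S}) (hST : S ≠ T) :
      IsLowerDimFace (tile a w (l (e S)) ∩ tile a w (l (e T))) (tile a w (l (e S))) :=
    ⟨isExposed_tile_inter a w _ _, fun _ => affineDim_tile_inter_lt (hne S T hST) (htop S)⟩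
  refine ⟨⟨?_, fun S T hST => ⟨hface S T hST, ?_⟩⟩, fun S T hST => ?_⟩
  · rw [he.iUnion_comp fun S => tile a w (l S)]
    exact iUnion_tile_eq h w l hl
  · rw [Set.inter_comm]
    exact hface T S hST.symm
  · by_contra hne'
    have hlt := affineDim_tile_inter_lt (hne S T hne') (htop S)
    dsimp only at hST
    rw [← hST, Set.inter_self] at hlt
    exact hlt.false

end Covering

theorem card_subtype_le_choose {ι : Type*} [Fintype ι] (n : ℕ) (p : Finset ι → Prop) :
    Nat.card {S : Finset ι // S.card = n ∧ p S} ≤ (Fintype.card ι).choose n ∧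
    (Nat.card {S : Finset ι // S.card = n ∧ p S} = (Fintype.card ι).choose n ↔
      ∀ S : Finset ι, S.card = n → p S) := by
  classical
  have hcard : Nat.card {S : Finset ι // S.card = n ∧ p S} =
      ((Finset.powersetCard n Finset.univ).filter p).card := by
    rw [Nat.card_eq_fintype_card, Fintype.card_subtype]
    congr 1
    ext S
    simp
  have huniv : (Finset.powersetCard n (Finset.univ : Finset ι)).card =
      (Fintype.card ι).choose n := by simp
  rw [hcard, ← huniv]
  refine ⟨Finset.card_filter_le _ _, ?_⟩
  rw [Finset.card_filter_eq_iff]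
  simp

end ZonotopeTiling

theorem proposition3p2 (n k : ℕ) (a : Fin k → EuclideanSpace ℝ (Fin n))
    (hdim : ZonotopeTiling.affineDim (ZonotopeTiling.zonotope a) = n) :
    (∃ x : {S : Finset (Fin k) // ZonotopeTiling.IsParallelotopeIndex a S} →
          EuclideanSpace ℝ (Fin n),
      ZonotopeTiling.IsTiling (ZonotopeTiling.zonotope a)
        (fun S => ZonotopeTiling.translatedSubzonotope a S.1 (x S)) ∧
      (Set.range fun S => ZonotopeTiling.translatedSubzonotope a S.1 (x S)).ncard =
        Nat.card {S : Finset (Fin k) // ZonotopeTiling.IsParallelotopeIndex a S}) ∧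
    Nat.card {S : Finset (Fin k) // ZonotopeTiling.IsParallelotopeIndex a S} ≤ k.choose n ∧
    (Nat.card {S : Finset (Fin k) // ZonotopeTiling.IsParallelotopeIndex a S} = k.choose n ↔
      ∀ S : Finset (Fin k), S.card = n → LinearIndependent ℝ (fun i : S => a i)) := by
  have htop : vectorSpan ℝ (ZonotopeTiling.zonotope a) = ⊤ :=
    Submodule.eq_top_of_finrank_eq (hdim.trans finrank_euclideanSpace_fin.symm)
  obtain ⟨x, hx, hinj⟩ := ZonotopeTiling.exists_isTiling htop
  refine ⟨⟨x, hx, Set.ncard_range_of_injective hinj⟩, ?_⟩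
  simp only [ZonotopeTiling.isParallelotopeIndex_iff_card (ZonotopeTiling.span_range_eq_top htop),
    finrank_euclideanSpace_fin]
  simpa using ZonotopeTiling.card_subtype_le_choose (ι := Fin k) n
    fun S => LinearIndependent ℝ (fun i : S => a i)
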